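/- Let $n\ge 0$ and $\mathbb{R}_+=[0,\infty)$. For $p\ge 1$ let $\boldsymbol\pi=(\pi_1,\dots,\pi_p)$ be a probability vector, $\boldsymbol T$ a $p\times p$ sub-intensity matrix (non-negative off-diagonal entries, exit rates $\boldsymbol t=-\boldsymbol T\boldsymbol e\ge 0$ where $\boldsymbol e=(1,\dots,1)^\top$, and from every state a state with positive exit rate can be reached through positive off-diagonal entries, i.e. all $p$ states are transient), and $\boldsymbol R=(r_{ik})$ a $p\times n$ matrix with non-negative entries. For $0<\alpha\le 1$, $\mathrm{MPH}^*_\alpha(\boldsymbol\pi,\boldsymbol T,\boldsymbol R)$ is the distribution on $\mathbb{R}_+^n$ characterized by the joint Laplace transform $$\int e^{-\langle \boldsymbol y,\boldsymbol\theta\rangle}\,d\mu(\boldsymbol y)=\boldsymbol\pi\,\bigl(\boldsymbol\Delta(\boldsymbol R\boldsymbol\theta)^\alpha-\boldsymbol T\bigr)^{-1}\boldsymbol t,\qquad \boldsymbol\theta\in\mathbb{R}_+^n,$$ where $\boldsymbol\Delta(\boldsymbol R\boldsymbol\theta)^\alpha$ is the diagonal matrix with entries $\bigl(\sum_k r_{ik}\theta_k\bigr)^\alpha$,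 $i=1,\dots,p$. Let $\mathrm{MPH}^*_\alpha$ be the class of all these distributions, with $p,\boldsymbol\pi,\boldsymbol T,\boldsymbol R$ arbitrary, and for $\boldsymbol\nu=(\nu_1,\dots,\nu_n)$ with all $\nu_i>0$ let $\mathrm{MPH}_\alpha^{*1/\boldsymbol\nu}$ be the class of the laws of $(X_1^{1/\nu_1},\dots,X_n^{1/\nu_n})$ where the law of $(X_1,\dots,X_n)$ belongs to $\mathrm{MPH}^*_\alpha$. Then, in the topology of weak convergence on the set of all Borel probability measures on $\mathbb{R}_+^n$: (i) The union of the classes $\mathrm{MPH}^*_\alpha$ over $0<\alpha<1$ is dense (hence so is the union over $0<\alpha\le1$). (ii) For every fixed $\alpha\in(0,1]$, the union of the classes $\mathrm{MPH}_\alpha^{*1/\boldsymbol\nu}$ over all $\boldsymbol\nu\in(0,\infty)^n$ is dense. (iii) For every fixed vector $(\beta_1,\dots,\beta_n)\in(0,\infty)^n$, the union of the classes $\mathrm{MPH}_\alpha^{*1/\boldsymbol\nu}$ over all $0<\alpha<1$ and all $\boldsymbol\nu\in(0,\infty)^n$ with $(\alpha/\nu_1,\dots,\alpha/\nu_n)=(\beta_1,\dots,\beta_n)$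 is dense; this remains true if only those members are used none of whose marginals is the point mass at $0$. -/

import Mathlib

open MeasureTheory
open scoped NNReal Matrix

namespace FractionalPhaseType

/-- The column vector `t = -T e` of the intensities of jumping to the absorbing state. -/
def exitRate {p : ℕ} (T : Matrix (Fin p) (Fin p) ℝ) (i : Fin p) : ℝ :=
  -∑ j, T i j

/-- `T` is the `p × p` sub-intensity matrix of the transient states of a Markov jump process on
`p` transient states and one absorbing state. Transience of the `p` states means that from each of
them the absorbing state can be reached through jumps of positive rate. -/
structure IsSubIntensity {p : ℕ} (T : Matrix (Fin p) (Fin p) ℝ) : Prop where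
  offDiag_nonneg : ∀ i j, i ≠ j → 0 ≤ T i j
  exitRate_nonneg : ∀ i, 0 ≤ exitRate T i
  transient : ∀ i, ∃ j, Relation.ReflTransGen (fun a b => 0 < T a b) i j ∧ 0 < exitRate T j

/-- A probability vector: an initial distribution concentrated on the transient states. -/
structure IsInitial {p : ℕ} (π : Fin p → ℝ) : Prop where
  nonneg : ∀ i, 0 ≤ π i
  sum_eq_one : ∑ i, π i = 1

/-- The diagonal matrix `Δ(R θ)^α`, whose `i`-th entry is `⟨r_i, θ⟩ ^ α`,
with `r_i` the `i`-th row of `R`. -/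
noncomputable def rewardDiag {p n : ℕ} (α : ℝ) (R : Matrix (Fin p) (Fin n) ℝ)
    (θ : Fin n → ℝ≥0) : Matrix (Fin p) (Fin p) ℝ :=
  Matrix.diagonal fun i => (∑ k, R i k * (θ k : ℝ)) ^ α

/-- The matrix that is inverted in the Laplace transform of a multivariate fractional phase-type
distribution is nonsingular, so `⁻¹` below is the true inverse. -/
theorem isUnit_det_rewardDiag_sub {p n : ℕ} (α : ℝ) {T : Matrix (Fin p) (Fin p) ℝ}
    (hT : IsSubIntensity T) {R : Matrix (Fin p) (Fin n) ℝ} (hR : ∀ i k, 0 ≤ R i k)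
    (θ : Fin n → ℝ≥0) : IsUnit (rewardDiag α R θ - T).det := by
  rw [isUnit_iff_ne_zero]
  intro hdet
  obtain ⟨v, hv0, hv⟩ := Matrix.exists_mulVec_eq_zero_iff.mpr hdet
  obtain ⟨i₀, hi₀⟩ := Function.ne_iff.mp hv0
  obtain ⟨m, -, hm⟩ := Finset.exists_max_image Finset.univ (fun i => |v i|) ⟨i₀, Finset.mem_univ _⟩
  have hmpos : 0 < |v m| := lt_of_lt_of_le (abs_pos.mpr hi₀) (hm i₀ (Finset.mem_univ _))
  -- the key estimate at a state where `|v|` is maximal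
  have key : ∀ i, |v i| = |v m| →
      exitRate T i * |v m| + ∑ j ∈ Finset.univ.erase i, T i j * (|v m| - |v j|) ≤ 0 := by
    intro i hi
    set d : ℝ := (∑ k, R i k * (θ k : ℝ)) ^ α with hd
    have hd0 : 0 ≤ d := Real.rpow_nonneg
      (Finset.sum_nonneg fun k _ => mul_nonneg (hR i k) (θ k).2) α
    have h1 : (d - T i i) * v i = ∑ j ∈ Finset.univ.erase i, T i j * v j := by
      have h := congrFun hv i
      rw [Matrix.sub_mulVec, Pi.sub_apply, rewardDiag, Matrix.mulVec_diagonal] at h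
      simp only [Pi.zero_apply, Matrix.mulVec, dotProduct] at h
      rw [← Finset.add_sum_erase _ _ (Finset.mem_univ i)] at h
      linarith
    have h2 : (d - T i i) * |v i| ≤ ∑ j ∈ Finset.univ.erase i, T i j * |v j| := by
      calc (d - T i i) * |v i| ≤ |d - T i i| * |v i| :=
            mul_le_mul_of_nonneg_right (le_abs_self _) (abs_nonneg _)
        _ = |∑ j ∈ Finset.univ.erase i, T i j * v j| := by rw [← abs_mul, h1]
        _ ≤ ∑ j ∈ Finset.univ.erase i, |T i j * v j| := Finset.abs_sum_le_sum_abs _ _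
        _ = ∑ j ∈ Finset.univ.erase i, T i j * |v j| := by
            refine Finset.sum_congr rfl fun j hj => ?_
            rw [abs_mul, abs_of_nonneg (hT.offDiag_nonneg i j (Finset.ne_of_mem_erase hj).symm)]
    have h3 : exitRate T i = -T i i - ∑ j ∈ Finset.univ.erase i, T i j := by
      rw [exitRate, ← Finset.add_sum_erase _ _ (Finset.mem_univ i)]; ring
    have h4 : 0 ≤ d * |v m| := mul_nonneg hd0 hmpos.le
    simp only [mul_sub, Finset.sum_sub_distrib, ← Finset.sum_mul]
    rw [h3]
    rw [hi] at h2
    nlinarith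
  have hsum : ∀ i, ∀ j ∈ Finset.univ.erase i, 0 ≤ T i j * (|v m| - |v j|) := fun i j hj =>
    mul_nonneg (hT.offDiag_nonneg i j (Finset.ne_of_mem_erase hj).symm)
      (sub_nonneg.mpr (hm j (Finset.mem_univ _)))
  have hall : ∀ j, Relation.ReflTransGen (fun a b => 0 < T a b) m j → |v j| = |v m| := by
    intro j hpath
    induction hpath with
    | refl => rfl
    | @tail b c _ hbc hb =>
      by_contra hne
      have hcb : c ≠ b := by rintro rfl; exact hne hb
      have h := key b hb
      have h5 := Finset.single_le_sum (hsum b) (Finset.mem_erase.mpr ⟨hcb, Finset.mem_univ c⟩)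
      have h6 := mul_nonneg (hT.exitRate_nonneg b) hmpos.le
      have h7 := mul_pos hbc (sub_pos.mpr (lt_of_le_of_ne (hm c (Finset.mem_univ _)) hne))
      linarith
  obtain ⟨j, hpath, hj⟩ := hT.transient m
  have hjm := hall j hpath
  have h := key j hjm
  have h5 := Finset.sum_nonneg (hsum j)
  have h6 := mul_pos hj hmpos
  linarith

/-- `μ` is the multivariate fractional phase-type distribution `MPH*_α(π, T, R)`: the distribution
on `ℝ₊ⁿ` of the rewards collected until absorption, characterized by its joint Laplace transform
`θ ↦ π (Δ(R θ)^α - T)⁻¹ t`. -/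
def HasMPHStarLaw {p n : ℕ} (α : ℝ) (π : Fin p → ℝ) (T : Matrix (Fin p) (Fin p) ℝ)
    (R : Matrix (Fin p) (Fin n) ℝ) (μ : ProbabilityMeasure (Fin n → ℝ≥0)) : Prop :=
  ∀ θ : Fin n → ℝ≥0,
    ∫ y, Real.exp (-∑ k, (y k : ℝ) * (θ k : ℝ)) ∂(μ : Measure (Fin n → ℝ≥0)) =
      π ⬝ᵥ ((rewardDiag α R θ - T)⁻¹ *ᵥ exitRate T)

/-- The class `MPH*_α` of distributions on `ℝ₊ⁿ`: the parameters `π`, `T`, `R` and the number `p`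
of transient states are arbitrary, and `α` is fixed. -/
def MPHStar (n : ℕ) (α : ℝ) : Set (ProbabilityMeasure (Fin n → ℝ≥0)) :=
  {μ | ∃ (p : ℕ) (π : Fin p → ℝ) (T : Matrix (Fin p) (Fin p) ℝ) (R : Matrix (Fin p) (Fin n) ℝ),
    IsInitial π ∧ IsSubIntensity T ∧ (∀ i k, 0 ≤ R i k) ∧ HasMPHStarLaw α π T R μ}

/-- The componentwise power `x ↦ x^(1/ν) = (x_1^(1/ν_1), …, x_n^(1/ν_n))`. -/
noncomputable def invPow {n : ℕ} (ν : Fin n → ℝ) (x : Fin n → ℝ≥0) : Fin n → ℝ≥0 :=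
  fun k => x k ^ (1 / ν k)

theorem measurable_invPow {n : ℕ} (ν : Fin n → ℝ) : Measurable (invPow ν) :=
  measurable_pi_lambda _ fun k => (measurable_pi_apply k).pow_const _

/-- The class `MPH*_α^(1/ν)` for fixed `α` and `ν`: the laws of `X^(1/ν)`, where the law of `X` is
in `MPH*_α`. -/
def MPHStarPow (n : ℕ) (α : ℝ) (ν : Fin n → ℝ) : Set (ProbabilityMeasure (Fin n → ℝ≥0)) :=
  (fun μ => μ.map (measurable_invPow ν).aemeasurable) '' MPHStar n α

end FractionalPhaseType

/-!
Multiplicative convolution `ρ * τ` (the law of `X * Y` for independent `X ∼ ρ` and `Y ∼ τ`) is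
continuous, and the point mass at `(1, …, 1)` is neutral for it. So if `τ j` converges to that point
mass, then `ρ * τ j` converges to `ρ`, and it is enough to let `ρ` run through the dense set of
finitely supported laws with support in the open orthant.

For `τ j` we take the law of `(X ^ γ₁, …, X ^ γₙ)`, where `X` is a sum of `m` independent
Mittag-Leffler variables of index `α` and mean scale `1 / m`. For `γ = (1, …, 1)` the product
`ρ * τ j` is in `MPH*_α`: choose the reward row `b` with probability `ρ {b}` and run an Erlang chain
with these rewards; powers are multiplicative, so other exponents lead to the classes
`MPH*_α^(1/ν)`. The Laplace transform of `X` is `(1 + s ^ α / m) ^ (-m)`, which tends to `exp (-s)`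
as `α → 1` and `m → ∞`, so `X` tends to `1`. For fixed `α` the vector tends to `(1, …, 1)` as
`γ → 0`, because `X` has no atom at `0`.
-/

namespace FractionalPhaseType

open Filter Topology
open scoped ENNReal

section MomentFunctions

open unitInterval

/-- `f` is the moment function `s ↦ ∫ y ^ s` of a probability measure on `[0, 1]`, that is, the
Laplace transform of a law on the compact space `[0, ∞]` with `y = exp (-x)`. Only `s > 0` is
considered, where `s ↦ 0 ^ s` vanishes: an atom at `0` is mass that has escaped. -/
def IsMomentFunction (f : ℝ → ℝ) : Prop :=
  ∃ μ : ProbabilityMeasure I, ∀ s : ℝ, 0 < s → ∫ y, (y : ℝ) ^ s ∂(μ : Measure I) = f s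

variable {f g L : ℝ → ℝ} {s α : ℝ}

theorem continuous_unitInterval_rpow (hs : 0 < s) : Continuous fun y : I => (y : ℝ) ^ s :=
  (Real.continuous_rpow_const hs.le).comp continuous_subtype_val

theorem integrable_unitInterval_rpow (μ : Measure I) [IsFiniteMeasure μ] (hs : 0 < s) :
    Integrable (fun y : I => (y : ℝ) ^ s) μ :=
  (continuous_unitInterval_rpow hs).integrable_of_hasCompactSupport
    (HasCompactSupport.of_compactSpace _)

theorem isMomentFunction_rpow (y : I) : IsMomentFunction fun s => (y : ℝ) ^ s :=
  ⟨diracProba y, fun _ _ => integral_dirac _ y⟩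

theorem IsMomentFunction.congr (hf : IsMomentFunction f) (h : ∀ s, 0 < s → f s = g s) :
    IsMomentFunction g := by
  obtain ⟨μ, hμ⟩ := hf
  exact ⟨μ, fun s hs => (hμ s hs).trans (h s hs)⟩

theorem IsMomentFunction.nonneg (hf : IsMomentFunction f) (hs : 0 < s) : 0 ≤ f s := by
  obtain ⟨μ, hμ⟩ := hf
  rw [← hμ s hs]
  exact integral_nonneg fun y => Real.rpow_nonneg y.2.1 s

theorem IsMomentFunction.mul (hf : IsMomentFunction f) (hg : IsMomentFunction g) :
    IsMomentFunction fun s => f s * g s := by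
  obtain ⟨μ, hμ⟩ := hf
  obtain ⟨ν, hν⟩ := hg
  have hmul : Measurable fun z : I × I => z.1 * z.2 := by fun_prop
  refine ⟨(μ.prod ν).map hmul.aemeasurable, fun s hs => ?_⟩
  beta_reduce
  rw [← hμ s hs, ← hν s hs, ← integral_prod_mul, ProbabilityMeasure.toMeasure_map,
    ProbabilityMeasure.toMeasure_prod, integral_map hmul.aemeasurable
      (continuous_unitInterval_rpow hs).aestronglyMeasurable]
  exact integral_congr_ae (ae_of_all _ fun z => Real.mul_rpow z.1.2.1 z.2.2.1)

theorem IsMomentFunction.pow (hf : IsMomentFunction f) (m : ℕ) :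
    IsMomentFunction fun s => f s ^ m := by
  induction m with
  | zero => simpa using isMomentFunction_rpow 1
  | succ m ih => simpa only [pow_succ] using ih.mul hf

theorem isMomentFunction_of_tendsto {F : ℕ → ℝ → ℝ} (hF : ∀ j, IsMomentFunction (F j))
    (h : ∀ s, 0 < s → Tendsto (fun j => F j s) atTop (𝓝 (f s))) : IsMomentFunction f := by
  choose μ hμ using hF
  obtain ⟨ρ, φ, hφ, hρ⟩ := CompactSpace.tendsto_subseq μ
  refine ⟨ρ, fun s hs => ?_⟩
  have hlim := ProbabilityMeasure.tendsto_iff_forall_integral_tendsto.mp hρ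
    (BoundedContinuousFunction.mkOfCompact ⟨_, continuous_unitInterval_rpow hs⟩)
  refine tendsto_nhds_unique hlim ?_
  simpa [Function.comp_def, hμ _ s hs] using (h s hs).comp hφ.tendsto_atTop

theorem isMomentFunction_of_hasSum {ι : Type*} [Countable ι] {F : ι → ℝ → ℝ}
    (hF : ∀ i, IsMomentFunction (F i)) {w : ι → ℝ≥0} (hw : ∑' i, (w i : ℝ≥0∞) ≤ 1)
    (hf : ∀ s, 0 < s → HasSum (fun i => w i * F i s) (f s)) : IsMomentFunction f := by
  choose μ hμ using hF
  let mix : Measure I := Measure.sum fun i => w i • (μ i : Measure I)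
  have hmix : mix Set.univ = ∑' i, (w i : ℝ≥0∞) := by simp [mix, Measure.sum_apply]
  have : IsFiniteMeasure mix := ⟨by rw [hmix]; exact hw.trans_lt ENNReal.one_lt_top⟩
  -- The mass missing from the mixture is put at `0`, where it contributes nothing.
  let ρ : Measure I := mix + (1 - mix Set.univ) • Measure.dirac 0
  have hρ : IsProbabilityMeasure ρ := ⟨by simp [ρ, add_tsub_cancel_of_le, hmix, hw]⟩
  refine ⟨⟨ρ, hρ⟩, fun s hs => (hf s hs).unique ?_ |>.symm⟩
  have hint := integrable_unitInterval_rpow mix hs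
  have hdirac : ∫ y : I, (y : ℝ) ^ s ∂((1 - mix Set.univ) • Measure.dirac 0) = 0 := by
    simp [integral_smul_measure, hs.ne']
  have hsum : HasSum (fun i => w i * F i s) (∫ y, (y : ℝ) ^ s ∂mix) := by
    simpa only [integral_smul_nnreal_measure, hμ _ s hs] using! hasSum_integral_measure hint
  change HasSum _ (∫ y : I, (y : ℝ) ^ s ∂ρ)
  rwa [integral_add_measure hint
    ((integrable_unitInterval_rpow _ hs).smul_measure (by finiteness)), hdirac, add_zero]

theorem tsum_coe_le_one_of_hasSum_powerSeries {a : ℕ → ℝ≥0}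
    (hg : ∀ z ∈ Set.Ico (0 : ℝ) 1, HasSum (fun k => a k * z ^ k) (g z))
    (hg1 : ∀ z ∈ Set.Ico (0 : ℝ) 1, g z ≤ 1) : ∑' k, (a k : ℝ≥0∞) ≤ 1 := by
  refine ENNReal.tsum_le_of_sum_range_le fun K => ?_
  have hcont : Continuous fun z : ℝ => ∑ k ∈ Finset.range K, a k * z ^ k := by fun_prop
  have hlim : Tendsto (fun z : ℝ => ∑ k ∈ Finset.range K, a k * z ^ k) (𝓝[<] 1)
      (𝓝 (∑ k ∈ Finset.range K, (a k : ℝ))) := by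
    simpa using (hcont.tendsto 1).mono_left nhdsWithin_le_nhds
  have hle : ∑ k ∈ Finset.range K, (a k : ℝ) ≤ 1 := by
    refine le_of_tendsto hlim ?_
    filter_upwards [Ioo_mem_nhdsLT (zero_lt_one' ℝ)] with z hz
    have hz' := Set.Ioo_subset_Ico_self hz
    exact (sum_le_hasSum _ (fun k _ => mul_nonneg (a k).2 (pow_nonneg hz.1.le k))
      (hg z hz')).trans (hg1 z hz')
  exact_mod_cast hle

/-- Composition with a probability generating function. -/
theorem IsMomentFunction.comp_powerSeries (hL : IsMomentFunction L) (hL1 : ∀ s, 0 < s → L s < 1)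
    {a : ℕ → ℝ} (ha : ∀ k, 0 ≤ a k)
    (hg : ∀ z ∈ Set.Ico (0 : ℝ) 1, HasSum (fun k => a k * z ^ k) (g z))
    (hg1 : ∀ z ∈ Set.Ico (0 : ℝ) 1, g z ≤ 1) : IsMomentFunction fun s => g (L s) := by
  lift a to ℕ → ℝ≥0 using ha
  exact isMomentFunction_of_hasSum hL.pow (tsum_coe_le_one_of_hasSum_powerSeries hg hg1)
    fun s hs => hg (L s) ⟨hL.nonneg hs, hL1 s hs⟩

theorem choose_succ_mul (α : ℝ) (k : ℕ) :
    Ring.choose α (k + 1) * (k + 1) = Ring.choose α k * (α - k) := by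
  have h := Ring.choose_smul_choose α (n := k + 1) (k := k) (Nat.le_succ k)
  simpa [nsmul_eq_mul, mul_comm] using h

theorem neg_one_pow_mul_choose_succ_nonneg (h0 : 0 ≤ α) (h1 : α ≤ 1) (k : ℕ) :
    0 ≤ (-1) ^ k * Ring.choose α (k + 1) := by
  induction k with
  | zero => simpa using h0
  | succ k ih =>
    have hrec : (-1) ^ (k + 1) * Ring.choose α (k + 1 + 1) =
        (-1) ^ k * Ring.choose α (k + 1) * ((k + 1 - α) / (k + 2)) := by
      have h := choose_succ_mul α (k + 1)
      push_cast at h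
      rw [mul_div_assoc', eq_div_iff (by positivity)]
      linear_combination (-1) ^ (k + 1) * h
    rw [hrec]
    exact mul_nonneg ih (div_nonneg (by linarith [k.cast_nonneg (α := ℝ)]) (by positivity))

theorem hasSum_one_sub_one_sub_rpow (α : ℝ) {z : ℝ} (hz : |z| < 1) :
    HasSum (fun k : ℕ => (-1) ^ k * Ring.choose α (k + 1) * z ^ (k + 1)) (1 - (1 - z) ^ α) := by
  have hbinom := (Real.one_add_rpow_hasFPowerSeriesOnBall_zero (a := α)).hasSum (y := -z) (by
    simpa [enorm_eq_nnnorm, ← NNReal.coe_lt_coe] using hz)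
  have htail := ((hasSum_nat_add_iff' 1).mpr hbinom).neg
  simp only [binomialSeries_apply, List.ofFn_const, List.prod_replicate, smul_eq_mul,
    Finset.range_one, Finset.sum_singleton, Ring.choose_zero_right, pow_zero, mul_one, neg_sub,
    zero_add, ← sub_eq_add_neg (1 : ℝ) z] at htail
  convert! htail using 2 with k
  rw [neg_pow z (k + 1), pow_succ (-1 : ℝ) k]
  ring

/-- Composition with the generating function of the Sibuya distribution. -/
theorem IsMomentFunction.one_sub_one_sub_rpow (hL : IsMomentFunction L)
    (hL1 : ∀ s, 0 < s → L s < 1) (h0 : 0 ≤ α) (h1 : α ≤ 1) :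
    IsMomentFunction fun s => 1 - (1 - L s) ^ α := by
  let a : ℕ → ℝ := fun k => if k = 0 then 0 else (-1) ^ (k - 1) * Ring.choose α k
  refine hL.comp_powerSeries (a := a) (g := fun z => 1 - (1 - z) ^ α) hL1 (fun k => ?_)
    (fun z hz => ?_) fun z hz => sub_le_self _ (Real.rpow_nonneg (sub_nonneg.mpr hz.2.le) α)
  · cases k with
    | zero => exact le_rfl
    | succ k => exact neg_one_pow_mul_choose_succ_nonneg h0 h1 k
  · rw [← hasSum_nat_add_iff' 1]
    simpa [a] using hasSum_one_sub_one_sub_rpow α (abs_lt.mpr ⟨by linarith [hz.1], hz.2⟩)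

/-- Composition with the generating function `1 / (1 + c (1 - z))` of a geometric distribution. -/
theorem IsMomentFunction.inv_one_add_mul_one_sub (hL : IsMomentFunction L)
    (hL1 : ∀ s, 0 < s → L s < 1) {c : ℝ} (hc : 0 ≤ c) :
    IsMomentFunction fun s => (1 + c * (1 - L s))⁻¹ := by
  let q : ℝ := c / (1 + c)
  refine hL.comp_powerSeries (a := fun k => (1 + c)⁻¹ * q ^ k)
    (g := fun z => (1 + c * (1 - z))⁻¹) hL1 (fun k => by positivity) (fun z hz => ?_)
    fun z hz => ?_
  all_goals have hcz : 0 ≤ c * (1 - z) := mul_nonneg hc (sub_nonneg.mpr hz.2.le)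
  · have hqz : q * z < 1 := by
      rw [div_mul_eq_mul_div, div_lt_one (by positivity)]
      linarith
    have hgeom := (hasSum_geometric_of_lt_one (mul_nonneg (by positivity) hz.1) hqz).mul_left
      (1 + c)⁻¹
    have heq : (1 + c)⁻¹ * (1 - q * z)⁻¹ = (1 + c * (1 - z))⁻¹ := by
      rw [← mul_inv]
      congr 1
      simp only [q]
      field_simp
      ring
    simpa only [mul_pow, mul_assoc, heq] using hgeom
  · exact inv_le_one_of_one_le₀ (by linarith)

theorem tendsto_one_sub_exp_neg_mul_div (s : ℝ) :
    Tendsto (fun h : ℝ => (1 - Real.exp (-(h * s))) / h) (𝓝[≠] 0) (𝓝 s) := by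
  have hderiv : HasDerivAt (fun h : ℝ => 1 - Real.exp (-(h * s))) s 0 := by
    simpa using (((hasDerivAt_id (0 : ℝ)).mul_const s).neg.exp).const_sub 1
  simpa [div_eq_inv_mul] using hderiv.tendsto_slope_zero

/-- The Mittag-Leffler law is the limit, as the step `h` tends to `0`, of geometric sums of Sibuya
variables on the lattice `h ℕ`. -/
theorem isMomentFunction_inv_one_add_mul_rpow (h0 : 0 < α) (h1 : α ≤ 1) {c : ℝ} (hc : 0 ≤ c) :
    IsMomentFunction fun s => (1 + c * s ^ α)⁻¹ := by
  let h : ℕ → ℝ := fun j => 1 / (j + 1)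
  have hh : ∀ j, 0 < h j := fun j => by positivity
  have hexp : ∀ j s, 0 < s → Real.exp (-(h j * s)) < 1 := fun j s hs =>
    Real.exp_lt_one_iff.mpr (neg_lt_zero.mpr (mul_pos (hh j) hs))
  have hlattice : ∀ j, IsMomentFunction fun s => Real.exp (-(h j * s)) := fun j =>
    (isMomentFunction_rpow ⟨Real.exp (-h j), (Real.exp_pos _).le,
      Real.exp_le_one_iff.mpr (neg_nonpos.mpr (hh j).le)⟩).congr fun s _ => by
        simp only [← Real.exp_mul, neg_mul]
  have hsibuya_lt : ∀ j s, 0 < s → 1 - (1 - Real.exp (-(h j * s))) ^ α < 1 := fun j s hs =>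
    sub_lt_self _ (Real.rpow_pos_of_pos (sub_pos.mpr (hexp j s hs)) α)
  refine isMomentFunction_of_tendsto (fun j => ((hlattice j).one_sub_one_sub_rpow (hexp j)
    h0.le h1).inv_one_add_mul_one_sub (hsibuya_lt j)
      (div_nonneg hc (Real.rpow_nonneg (hh j).le α))) fun s hs => ?_
  have hstep : Tendsto h atTop (𝓝[≠] 0) := tendsto_nhdsWithin_iff.mpr
    ⟨tendsto_one_div_add_atTop_nhds_zero_nat, Eventually.of_forall fun j => (hh j).ne'⟩
  have hlim : Tendsto (fun j => (1 + c * ((1 - Real.exp (-(h j * s))) / h j) ^ α)⁻¹) atTop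
      (𝓝 (1 + c * s ^ α)⁻¹) :=
    (((((tendsto_one_sub_exp_neg_mul_div s).comp hstep).rpow_const (Or.inr h0.le)).const_mul
      c).const_add 1).inv₀ (by positivity)
  refine hlim.congr fun j => ?_
  rw [Real.div_rpow (sub_nonneg.mpr (hexp j s hs).le) (hh j).le]
  ring

theorem ae_ne_zero_of_tendsto_integral_rpow {μ : Measure I} [IsProbabilityMeasure μ]
    (h : Tendsto (fun s : ℝ => ∫ y, (y : ℝ) ^ s ∂μ) (𝓝[>] 0) (𝓝 1)) : ∀ᵐ y ∂μ, y ≠ 0 := by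
  have hle : ∀ s : ℝ, 0 < s → ∫ y, (y : ℝ) ^ s ∂μ ≤ μ.real {0}ᶜ := by
    intro s hs
    rw [← integral_indicator_one (measurableSet_singleton _).compl]
    refine integral_mono (integrable_unitInterval_rpow _ hs)
      ((integrable_const (1 : ℝ)).indicator (measurableSet_singleton _).compl) fun y => ?_
    by_cases hy : y = 0
    · simp [hy, hs.ne']
    · simpa [hy] using Real.rpow_le_one y.2.1 y.2.2 hs.le
  have hone : 1 ≤ μ.real {0}ᶜ := le_of_tendsto h (eventually_nhdsWithin_of_forall hle)
  rw [probReal_compl_eq_one_sub (measurableSet_singleton _)] at hone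
  have hzero : μ.real {0} = 0 := le_antisymm (by linarith) measureReal_nonneg
  simpa [ae_iff] using (measureReal_eq_zero_iff (by finiteness)).mp hzero

theorem IsMomentFunction.exists_laplace (hf : IsMomentFunction f)
    (h1 : Tendsto f (𝓝[>] 0) (𝓝 1)) :
    ∃ ρ : ProbabilityMeasure ℝ≥0, ∀ s : ℝ, 0 < s →
      ∫ x, Real.exp (-(s * x)) ∂(ρ : Measure ℝ≥0) = f s := by
  obtain ⟨μ, hμ⟩ := hf
  have hne : ∀ᵐ y ∂(μ : Measure I), y ≠ 0 := ae_ne_zero_of_tendsto_integral_rpow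
    (h1.congr' (eventually_nhdsWithin_of_forall fun s hs => (hμ s hs).symm))
  have hm : Measurable fun y : I => Real.toNNReal (-Real.log y) := by fun_prop
  refine ⟨μ.map hm.aemeasurable, fun s hs => ?_⟩
  rw [ProbabilityMeasure.toMeasure_map, integral_map hm.aemeasurable (by fun_prop), ← hμ s hs]
  refine integral_congr_ae (hne.mono fun y hy => ?_)
  have hlog : 0 ≤ -Real.log y := neg_nonneg.mpr (Real.log_nonpos y.2.1 y.2.2)
  simp only [Real.coe_toNNReal _ hlog, Real.rpow_def_of_pos (unitInterval.pos_iff_ne_zero.mpr hy)]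
  ring_nf

end MomentFunctions

section ErlangMittagLeffler

/-- `σ` is the law of the sum of `m` independent Mittag-Leffler variables of index `α` and mean
scale `1 / m`, the fractional analogue of the Erlang distribution with `m` stages of rate `m`. The
law is encoded by its Laplace transform. -/
def IsErlangMittagLeffler (α : ℝ) (m : ℕ) (σ : ProbabilityMeasure ℝ≥0) : Prop :=
  ∀ s : ℝ, 0 ≤ s → ∫ x, Real.exp (-(s * x)) ∂(σ : Measure ℝ≥0) = ((1 + s ^ α / m) ^ m)⁻¹

theorem exists_isErlangMittagLeffler {α : ℝ} (h0 : 0 < α) (h1 : α ≤ 1) (m : ℕ) :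
    ∃ σ, IsErlangMittagLeffler α m σ := by
  have hmoment := (isMomentFunction_inv_one_add_mul_rpow h0 h1 (inv_nonneg.mpr m.cast_nonneg)).pow m
  have hcont : ContinuousAt (fun s : ℝ => (1 + (m : ℝ)⁻¹ * s ^ α)⁻¹ ^ m) 0 := by
    have := Real.continuous_rpow_const h0.le
    refine (ContinuousAt.inv₀ (by fun_prop) ?_).pow m
    simp [h0.ne']
  obtain ⟨σ, hσ⟩ := hmoment.exists_laplace (by
    simpa [h0.ne'] using hcont.tendsto.mono_left nhdsWithin_le_nhds)
  refine ⟨σ, fun s hs => ?_⟩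
  rcases hs.eq_or_lt with rfl | hs
  · simp [h0.ne']
  · rw [hσ s hs, inv_pow, div_eq_inv_mul]

end ErlangMittagLeffler

section FiniteStateSpace

variable {ι : Type*} [Fintype ι]

/-- The sub-intensity matrices over an arbitrary finite state space: the rows sum to at most zero,
and from each state a state whose row sum is negative can be reached. -/
structure IsTransientGenerator (T : Matrix ι ι ℝ) : Prop where
  offDiag_nonneg : ∀ i j, i ≠ j → 0 ≤ T i j
  sum_row_nonpos : ∀ i, ∑ j, T i j ≤ 0
  transient : ∀ i, ∃ j, Relation.ReflTransGen (fun a b => 0 < T a b) i j ∧ ∑ l, T j l < 0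

theorem exitRate_submatrix_equiv {p : ℕ} (T : Matrix ι ι ℝ) (e : Fin p ≃ ι) (i : Fin p) :
    exitRate (T.submatrix e e) i = -∑ j, T (e i) j := by
  simp only [exitRate, Matrix.submatrix_apply, e.sum_comp fun j => T (e i) j]

theorem IsTransientGenerator.isSubIntensity {p : ℕ} {T : Matrix ι ι ℝ}
    (hT : IsTransientGenerator T) (e : Fin p ≃ ι) : IsSubIntensity (T.submatrix e e) where
  offDiag_nonneg i j hij := hT.offDiag_nonneg _ _ (e.injective.ne hij)
  exitRate_nonneg i := by
    rw [exitRate_submatrix_equiv]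
    exact neg_nonneg.mpr (hT.sum_row_nonpos (e i))
  transient i := by
    obtain ⟨j, hpath, hj⟩ := hT.transient (e i)
    have hpath' := hpath.lift (p := fun a b => 0 < T.submatrix e e a b) e.symm
      fun a b h => by simpa [Function.onFun] using h
    refine ⟨e.symm j, by simpa [Function.onFun] using hpath', ?_⟩
    rw [exitRate_submatrix_equiv]
    simpa using hj

theorem mem_MPHStar_of_fintype {n : ℕ} {α : ℝ} {π : ι → ℝ} {T : Matrix ι ι ℝ}
    {R : Matrix ι (Fin n) ℝ} {μ : ProbabilityMeasure (Fin n → ℝ≥0)} (hπ : π ∈ stdSimplex ℝ ι)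
    (hT : IsTransientGenerator T) (hR : ∀ i k, 0 ≤ R i k)
    (hμ : ∀ θ : Fin n → ℝ≥0, ∃ v : ι → ℝ,
      (∀ i, (∑ k, R i k * (θ k : ℝ)) ^ α * v i - ∑ j, T i j * v j = -∑ j, T i j) ∧
      ∫ y, Real.exp (-∑ k, (y k : ℝ) * (θ k : ℝ)) ∂(μ : Measure (Fin n → ℝ≥0)) =
        ∑ i, π i * v i) :
    μ ∈ MPHStar n α := by
  let e := (Fintype.equivFin ι).symm
  have hsub := hT.isSubIntensity e
  let R' : Matrix (Fin (Fintype.card ι)) (Fin n) ℝ := fun i k => R (e i) k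
  refine ⟨Fintype.card ι, π ∘ e, T.submatrix e e, R', ⟨fun i => hπ.1 _, ?_⟩, hsub,
    fun i k => hR _ k, fun θ => ?_⟩
  · exact (e.sum_comp π).trans hπ.2
  obtain ⟨v, hv, hint⟩ := hμ θ
  have hunit := isUnit_det_rewardDiag_sub α hsub (R := R') (fun i k => hR _ k) θ
  have hsol : (rewardDiag α R' θ - T.submatrix e e) *ᵥ (v ∘ e) = exitRate (T.submatrix e e) := by
    funext i
    rw [exitRate_submatrix_equiv, ← hv (e i), Matrix.sub_mulVec, Pi.sub_apply, rewardDiag,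
      Matrix.mulVec_diagonal]
    congr 1
    exact e.sum_comp fun j => T (e i) j * v j
  rw [← hsol, Matrix.mulVec_mulVec, Matrix.nonsing_inv_mul _ hunit, Matrix.one_mulVec, hint]
  exact (e.sum_comp fun i => π i * v i).symm

/-- `σ` is the univariate fractional phase-type law with unit rewards: its Laplace transform is
`π ⬝ᵥ v`, with `v` the solution of the linear system `(s ^ α - T) v = -T e`. -/
def HasPhaseTypeLaw (α : ℝ) (π : ι → ℝ) (T : Matrix ι ι ℝ) (σ : ProbabilityMeasure ℝ≥0) : Prop :=
  ∀ s : ℝ, 0 ≤ s → ∃ v : ι → ℝ, (∀ i, s ^ α * v i - ∑ j, T i j * v j = -∑ j, T i j) ∧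
    ∫ x, Real.exp (-(s * x)) ∂(σ : Measure ℝ≥0) = ∑ i, π i * v i

theorem sum_blockDiagonal_const_mul {κ : Type*} [Fintype κ] [DecidableEq κ] (T : Matrix ι ι ℝ)
    (u : ι × κ → ℝ) (a : ι × κ) :
    ∑ b, Matrix.blockDiagonal (fun _ : κ => T) a b * u b = ∑ j, T a.1 j * u (j, a.2) := by
  simp [Fintype.sum_prod_type, Matrix.blockDiagonal_apply]

theorem sum_blockDiagonal_const {κ : Type*} [Fintype κ] [DecidableEq κ] (T : Matrix ι ι ℝ)
    (a : ι × κ) : ∑ b, Matrix.blockDiagonal (fun _ : κ => T) a b = ∑ j, T a.1 j := by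
  simpa using sum_blockDiagonal_const_mul T 1 a

theorem IsTransientGenerator.blockDiagonal_const {κ : Type*} [Fintype κ] [DecidableEq κ]
    {T : Matrix ι ι ℝ} (hT : IsTransientGenerator T) :
    IsTransientGenerator (Matrix.blockDiagonal fun _ : κ => T) where
  offDiag_nonneg a b hab := by
    rw [Matrix.blockDiagonal_apply]
    split_ifs with h
    · exact hT.offDiag_nonneg _ _ fun h' => hab (Prod.ext h' h)
    · exact le_rfl
  sum_row_nonpos a := (sum_blockDiagonal_const T a).trans_le (hT.sum_row_nonpos a.1)
  transient a := by
    obtain ⟨j, hpath, hj⟩ := hT.transient a.1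
    refine ⟨(j, a.2), hpath.lift (fun i => (i, a.2)) fun i l h => ?_, ?_⟩
    · simpa [Function.onFun, Matrix.blockDiagonal_apply] using h
    · rwa [sum_blockDiagonal_const]

end FiniteStateSpace

section ErlangChain

variable {α r : ℝ} {m : ℕ}

/-- The generator of a chain of `m + 1` stages of rate `r`. A state is the number of stages that
remain after the current one, so the chain is entered at `Fin.last m` and left from `0`. -/
def erlangChain (m : ℕ) (r : ℝ) : Matrix (Fin (m + 1)) (Fin (m + 1)) ℝ :=
  fun i j => (if j = i then -r else 0) + if (j : ℕ) + 1 = i then r else 0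

theorem sum_erlangChain_zero_mul (u : Fin (m + 1) → ℝ) :
    ∑ j, erlangChain m r 0 j * u j = -r * u 0 := by
  simp [erlangChain]

theorem sum_erlangChain_succ_mul (i : Fin m) (u : Fin (m + 1) → ℝ) :
    ∑ j, erlangChain m r i.succ j * u j = r * u i.castSucc - r * u i.succ := by
  have hpred : ∀ j : Fin (m + 1), (j : ℕ) + 1 = i.succ ↔ j = i.castSucc := fun j => by
    simp [Fin.ext_iff]
  simp only [erlangChain, hpred, add_mul, ite_mul, zero_mul, Finset.sum_add_distrib,
    Finset.sum_ite_eq', Finset.mem_univ, if_true]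
  ring

theorem sum_erlangChain_zero : ∑ j, erlangChain m r 0 j = -r := by
  simpa using sum_erlangChain_zero_mul (m := m) (r := r) 1

theorem sum_erlangChain_succ (i : Fin m) : ∑ j, erlangChain m r i.succ j = 0 := by
  simpa using sum_erlangChain_succ_mul (r := r) i 1

theorem isTransientGenerator_erlangChain (m : ℕ) (hr : 0 < r) :
    IsTransientGenerator (erlangChain m r) where
  offDiag_nonneg i j hij := by
    simp only [erlangChain, if_neg hij.symm]
    split_ifs <;> simp [hr.le]
  sum_row_nonpos i := by
    cases i using Fin.cases with
    | zero => simpa [sum_erlangChain_zero] using hr.le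
    | succ i => exact (sum_erlangChain_succ i).le
  transient i := by
    refine ⟨0, ?_, by simpa [sum_erlangChain_zero] using hr⟩
    induction i using Fin.induction with
    | zero => exact .refl
    | succ i ih => exact ih.head (by simp [erlangChain, hr, Fin.castSucc_lt_succ.ne])

theorem IsErlangMittagLeffler.hasPhaseTypeLaw {σ : ProbabilityMeasure ℝ≥0}
    (hσ : IsErlangMittagLeffler α (m + 1) σ) :
    HasPhaseTypeLaw α (Pi.single (Fin.last m) 1) (erlangChain m (m + 1)) σ := by
  intro s hs
  let q : ℝ := (1 + s ^ α / (m + 1))⁻¹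
  have hq : (m + 1 + s ^ α) * q = m + 1 := by
    have := Real.rpow_nonneg hs α
    simp only [q]
    field_simp
  refine ⟨fun i => q ^ ((i : ℕ) + 1), fun i => ?_, ?_⟩
  · cases i using Fin.cases with
    | zero =>
      rw [sum_erlangChain_zero_mul, sum_erlangChain_zero]
      simp only [Fin.val_zero, zero_add, pow_one]
      linear_combination hq
    | succ i =>
      rw [sum_erlangChain_succ_mul, sum_erlangChain_succ]
      simp only [Fin.val_succ, Fin.val_castSucc]
      linear_combination q ^ ((i : ℕ) + 1) * hq
  · rw [hσ s hs]
    simp [Pi.single_apply, q]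

end ErlangChain

section Products

variable {n : ℕ}

/-- The law of `X * Y` for independent `X ∼ μ` and `Y ∼ ν`. -/
noncomputable def mulConv {M : Type*} [Monoid M] [MeasurableSpace M] [MeasurableMul₂ M]
    (μ ν : ProbabilityMeasure M) : ProbabilityMeasure M :=
  ⟨(μ : Measure M).mconv ν, inferInstance⟩

theorem measurable_rpow_pi (γ : Fin n → ℝ) : Measurable fun (x : ℝ≥0) k => x ^ γ k :=
  measurable_pi_lambda _ fun _ => measurable_id.pow_const _

/-- The law of the vector `(X ^ γ₁, …, X ^ γₙ)` for a single random variable `X ∼ σ`. -/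
noncomputable def powLaw (σ : ProbabilityMeasure ℝ≥0) (γ : Fin n → ℝ) :
    ProbabilityMeasure (Fin n → ℝ≥0) :=
  σ.map (measurable_rpow_pi γ).aemeasurable

theorem integral_eq_sum_of_ae_mem_finset {E : Type*} [MeasurableSpace E]
    [MeasurableSingletonClass E] {μ : Measure E} [IsFiniteMeasure μ] {s : Finset E}
    (hs : ∀ᵐ y ∂μ, y ∈ s) (f : E → ℝ) : ∫ y, f y ∂μ = ∑ y ∈ s, μ.real {y} * f y := by
  simpa [Measure.restrict_eq_self_of_ae_mem (s := (s : Set E)) hs] using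
    setIntegral_finset s (.finset (μ := μ) (f := f))

theorem integrable_exp_neg_sum_mul (μ : Measure (Fin n → ℝ≥0)) [IsFiniteMeasure μ]
    (θ : Fin n → ℝ≥0) : Integrable (fun y => Real.exp (-∑ k, (y k : ℝ) * (θ k : ℝ))) μ := by
  refine .of_bound (Measurable.aestronglyMeasurable (by fun_prop)) 1 (ae_of_all _ fun y => ?_)
  rw [Real.norm_of_nonneg (Real.exp_pos _).le, Real.exp_le_one_iff, neg_nonpos]
  positivity

theorem integral_exp_mulConv_powLaw_one {ρ : ProbabilityMeasure (Fin n → ℝ≥0)}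
    {s : Finset (Fin n → ℝ≥0)} (hs : ∀ᵐ y ∂(ρ : Measure (Fin n → ℝ≥0)), y ∈ s)
    (σ : ProbabilityMeasure ℝ≥0) (θ : Fin n → ℝ≥0) :
    ∫ y, Real.exp (-∑ k, (y k : ℝ) * (θ k : ℝ))
        ∂(mulConv ρ (powLaw σ 1) : Measure (Fin n → ℝ≥0)) =
      ∑ b ∈ s, (ρ : Measure (Fin n → ℝ≥0)).real {b} *
        ∫ x, Real.exp (-((∑ k, (b k : ℝ) * (θ k : ℝ)) * x)) ∂(σ : Measure ℝ≥0) := by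
  have hint := integrable_exp_neg_sum_mul (mulConv ρ (powLaw σ 1) : Measure (Fin n → ℝ≥0)) θ
  refine (integral_mconv hint).trans ?_
  rw [integral_eq_sum_of_ae_mem_finset hs]
  refine Finset.sum_congr rfl fun b _ => congrArg _ ?_
  rw [powLaw, ProbabilityMeasure.toMeasure_map, integral_map (measurable_rpow_pi 1).aemeasurable
    (by fun_prop)]
  simp only [Pi.mul_apply, Pi.one_apply, NNReal.rpow_one, NNReal.coe_mul, Finset.sum_mul,
    mul_right_comm]

theorem mulConv_powLaw_one_mem_MPHStar {ι : Type*} [Fintype ι] {α : ℝ} {π : ι → ℝ}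
    {T : Matrix ι ι ℝ} {σ : ProbabilityMeasure ℝ≥0} (hπ : π ∈ stdSimplex ℝ ι)
    (hT : IsTransientGenerator T) (hσ : HasPhaseTypeLaw α π T σ)
    {ρ : ProbabilityMeasure (Fin n → ℝ≥0)} {s : Finset (Fin n → ℝ≥0)}
    (hs : ∀ᵐ y ∂(ρ : Measure (Fin n → ℝ≥0)), y ∈ s) :
    mulConv ρ (powLaw σ 1) ∈ MPHStar n α := by
  classical
  choose v hv hint using hσ
  let w : s → ℝ := fun b => (ρ : Measure (Fin n → ℝ≥0)).real {(b : Fin n → ℝ≥0)}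
  have hw : ∑ b, w b = 1 := by
    rw [Finset.sum_coe_sort s fun b => (ρ : Measure (Fin n → ℝ≥0)).real {b}]
    simpa using (integral_eq_sum_of_ae_mem_finset hs fun _ => 1).symm
  refine mem_MPHStar_of_fintype (π := fun a : ι × s => π a.1 * w a.2)
    (T := Matrix.blockDiagonal fun _ => T) (R := fun a k => a.2.1 k)
    ⟨fun a => mul_nonneg (hπ.1 _) measureReal_nonneg, ?_⟩ hT.blockDiagonal_const
    (fun a k => NNReal.coe_nonneg _) fun θ => ?_
  · simp only [Fintype.sum_prod_type, ← Finset.mul_sum, hw, mul_one, hπ.2]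
  have hθ : ∀ b : Fin n → ℝ≥0, 0 ≤ ∑ k, (b k : ℝ) * (θ k : ℝ) := fun b => by positivity
  refine ⟨fun a => v _ (hθ a.2) a.1, fun a => ?_, ?_⟩
  · rw [sum_blockDiagonal_const_mul T (fun a : ι × s => v _ (hθ a.2) a.1), sum_blockDiagonal_const]
    exact hv _ (hθ a.2) a.1
  · rw [integral_exp_mulConv_powLaw_one hs, ← Finset.sum_coe_sort s, Fintype.sum_prod_type_right]
    refine Finset.sum_congr rfl fun b _ => ?_
    rw [hint _ (hθ b), Finset.mul_sum]
    exact Finset.sum_congr rfl fun i _ => by ring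

theorem map_invPow_mulConv (ν : Fin n → ℝ) (μ μ' : ProbabilityMeasure (Fin n → ℝ≥0)) :
    (mulConv μ μ').map (measurable_invPow ν).aemeasurable =
      mulConv (μ.map (measurable_invPow ν).aemeasurable)
        (μ'.map (measurable_invPow ν).aemeasurable) :=
  let f : (Fin n → ℝ≥0) →* (Fin n → ℝ≥0) :=
    { toFun := invPow ν
      map_one' := funext fun _ => NNReal.one_rpow _
      map_mul' := fun _ _ => funext fun _ => NNReal.mul_rpow }
  Subtype.ext (Measure.map_mconv_monoidHom f (measurable_invPow ν))

theorem map_invPow_powLaw (ν γ : Fin n → ℝ) (σ : ProbabilityMeasure ℝ≥0) :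
    (powLaw σ γ).map (measurable_invPow ν).aemeasurable = powLaw σ (γ / ν) := by
  have hcomp : (invPow ν ∘ fun (x : ℝ≥0) k => x ^ γ k) = fun x k => x ^ (γ / ν) k := by
    ext x k
    simp [invPow, ← NNReal.rpow_mul, div_eq_mul_inv]
  apply ProbabilityMeasure.toMeasure_injective
  simp only [powLaw, ProbabilityMeasure.toMeasure_map]
  rw [Measure.map_map (measurable_invPow ν) (measurable_rpow_pi γ), hcomp]

theorem mulConv_powLaw_mem_MPHStarPow {ι : Type*} [Fintype ι] {α : ℝ} {π : ι → ℝ}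
    {T : Matrix ι ι ℝ} {σ : ProbabilityMeasure ℝ≥0} (hπ : π ∈ stdSimplex ℝ ι)
    (hT : IsTransientGenerator T) (hσ : HasPhaseTypeLaw α π T σ) {ν : Fin n → ℝ}
    (hν : ∀ k, ν k ≠ 0) {ρ : ProbabilityMeasure (Fin n → ℝ≥0)} {s : Finset (Fin n → ℝ≥0)}
    (hs : ∀ᵐ y ∂(ρ : Measure (Fin n → ℝ≥0)), y ∈ s) :
    mulConv ρ (powLaw σ (1 / ν)) ∈ MPHStarPow n α ν := by
  classical
  let pow (y : Fin n → ℝ≥0) (k : Fin n) : ℝ≥0 := y k ^ ν k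
  have hpow : Measurable pow := by fun_prop
  have hinv : invPow ν ∘ pow = id := by
    ext y k
    simp [invPow, pow, ← NNReal.rpow_mul, hν k]
  have hs' : ∀ᵐ y ∂(ρ.map hpow.aemeasurable : Measure (Fin n → ℝ≥0)), y ∈ s.image pow :=
    (ae_map_iff hpow.aemeasurable (s.image pow).measurableSet).mpr
      (hs.mono fun _ hy => Finset.mem_image_of_mem pow hy)
  have hρ : (ρ.map hpow.aemeasurable).map (measurable_invPow ν).aemeasurable = ρ := by
    apply ProbabilityMeasure.toMeasure_injective
    simp only [ProbabilityMeasure.toMeasure_map]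
    rw [Measure.map_map (measurable_invPow ν) hpow, hinv, Measure.map_id]
  refine ⟨_, mulConv_powLaw_one_mem_MPHStar hπ hT hσ hs', ?_⟩
  simp only [map_invPow_mulConv, hρ, map_invPow_powLaw]

end Products

section WeakConvergence

variable {ι : Type*} {l : Filter ι}

theorem tendsto_diracProba_iff [l.IsCountablyGenerated] {E : Type*} [TopologicalSpace E]
    [MeasurableSpace E] [OpensMeasurableSpace E] [HasOuterApproxClosed E]
    {μ : ι → ProbabilityMeasure E} {x : E} :
    Tendsto μ l (𝓝 (diracProba x)) ↔
      ∀ U, IsOpen U → x ∈ U → Tendsto (fun i => (μ i : Measure E) U) l (𝓝 1) := by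
  have hdirac {U : Set E} (hU : IsOpen U) :
      (diracProba x : Measure E) U = U.indicator 1 x :=
    diracProba_toMeasure_apply' x hU.measurableSet
  constructor
  · intro h U hU hx
    refine tendsto_of_le_liminf_of_limsup_le ?_ (limsup_le_of_le (by isBoundedDefault)
      (Eventually.of_forall fun i => prob_le_one))
    simpa [hdirac hU, hx] using ProbabilityMeasure.le_liminf_measure_open_of_tendsto h hU
  · intro h
    refine tendsto_of_forall_isOpen_le_liminf' fun U hU => ?_
    rcases l.eq_or_neBot with rfl | hl
    · simp
    by_cases hx : x ∈ U
    · simp [hdirac hU, hx, (h U hU hx).liminf_eq]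
    · simp [hdirac hU, hx]

theorem tendsto_map_diracProba [l.IsCountablyGenerated] {E F : Type*}
    [TopologicalSpace E] [MeasurableSpace E] [OpensMeasurableSpace E] [HasOuterApproxClosed E]
    [TopologicalSpace F] [MeasurableSpace F] [OpensMeasurableSpace F] [HasOuterApproxClosed F]
    {μ : ι → ProbabilityMeasure E} {x : E} (hμ : Tendsto μ l (𝓝 (diracProba x)))
    {f : ι → E → F} (hf : ∀ i, Measurable (f i)) {y : F}
    (hlim : Tendsto (Function.uncurry f) (l ×ˢ 𝓝 x) (𝓝 y)) :
    Tendsto (fun i => (μ i).map (hf i).aemeasurable) l (𝓝 (diracProba y)) := by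
  rw [tendsto_diracProba_iff] at hμ ⊢
  intro U hU hy
  obtain ⟨p, hp, q, hq, hpq⟩ := eventually_prod_iff.mp (hlim.eventually (hU.mem_nhds hy))
  obtain ⟨V, hVq, hV, hxV⟩ := eventually_nhds_iff.mp hq
  refine tendsto_of_tendsto_of_tendsto_of_le_of_le' (hμ V hV hxV) tendsto_const_nhds
    (hp.mono fun i hi => ?_) (Eventually.of_forall fun i => prob_le_one)
  rw [ProbabilityMeasure.toMeasure_map, Measure.map_apply (hf i) hU.measurableSet]
  exact measure_mono fun z hz => hpq hi (hVq z hz)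

theorem tendsto_diracProba_of_tendsto_integral_dist_sq [l.IsCountablyGenerated] {E : Type*}
    [PseudoMetricSpace E] [MeasurableSpace E] [OpensMeasurableSpace E]
    {μ : ι → ProbabilityMeasure E} {c : E}
    (hint : ∀ i, Integrable (fun x => dist x c ^ 2) (μ i : Measure E))
    (h : Tendsto (fun i => ∫ x, dist x c ^ 2 ∂(μ i : Measure E)) l (𝓝 0)) :
    Tendsto μ l (𝓝 (diracProba c)) := by
  rw [tendsto_diracProba_iff]
  intro U hU hc
  obtain ⟨ε, hε, hεU⟩ := Metric.isOpen_iff.mp hU c hc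
  have hcompl : Uᶜ ⊆ {x | ε ^ 2 ≤ dist x c ^ 2} := fun x hx =>
    pow_le_pow_left₀ hε.le (not_lt.mp fun hlt => hx (hεU hlt)) 2
  have hchebyshev i :
      1 - (∫ x, dist x c ^ 2 ∂(μ i : Measure E)) / ε ^ 2 ≤ (μ i : Measure E).real U := by
    rw [sub_le_comm, ← probReal_compl_eq_one_sub hU.measurableSet, le_div_iff₀' (by positivity)]
    exact (mul_le_mul_of_nonneg_left (measureReal_mono hcompl) (sq_nonneg ε)).trans
      (mul_meas_ge_le_integral_of_nonneg (ae_of_all _ fun x => sq_nonneg _) (hint i) (ε ^ 2))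
  have hreal : Tendsto (fun i => (μ i : Measure E).real U) l (𝓝 1) :=
    tendsto_of_tendsto_of_tendsto_of_le_of_le
      (by simpa using (h.div_const (ε ^ 2)).const_sub 1) tendsto_const_nhds hchebyshev
      fun i => measureReal_le_one
  exact (ENNReal.tendsto_toReal_iff (fun i => measure_ne_top _ _) ENNReal.one_ne_top).mp
    (by simpa only [Measure.real, ENNReal.toReal_one] using hreal)

theorem tendsto_diracProba_of_tendsto_moments [l.IsCountablyGenerated]
    {μ : ι → ProbabilityMeasure ℝ} {c : ℝ} (hμ : ∀ i, MemLp id 2 (μ i : Measure ℝ))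
    (h1 : Tendsto (fun i => ∫ x, x ∂(μ i : Measure ℝ)) l (𝓝 c))
    (h2 : Tendsto (fun i => ∫ x, x ^ 2 ∂(μ i : Measure ℝ)) l (𝓝 (c ^ 2))) :
    Tendsto μ l (𝓝 (diracProba c)) := by
  have hint1 i : Integrable (fun x => x) (μ i : Measure ℝ) := (hμ i).integrable one_le_two
  have hint2 i : Integrable (fun x => x ^ 2) (μ i : Measure ℝ) := (hμ i).integrable_sq
  have hexpand (x : ℝ) : dist x c ^ 2 = x ^ 2 - 2 * c * x + c ^ 2 := by
    rw [Real.dist_eq, sq_abs]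
    ring
  refine tendsto_diracProba_of_tendsto_integral_dist_sq (fun i => ?_) ?_
  · simp only [hexpand]
    exact ((hint2 i).sub ((hint1 i).const_mul _)).add (integrable_const (c ^ 2))
  · have hintegral i : ∫ x, dist x c ^ 2 ∂(μ i : Measure ℝ) =
        ∫ x, x ^ 2 ∂(μ i : Measure ℝ) - 2 * c * ∫ x, x ∂(μ i : Measure ℝ) + c ^ 2 := by
      simp only [hexpand]
      rw [integral_add (f := fun x : ℝ => x ^ 2 - 2 * c * x)
        ((hint2 i).sub ((hint1 i).const_mul _)) (integrable_const _),
        integral_sub (hint2 i) ((hint1 i).const_mul _), integral_const_mul]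
      simp
    simp only [hintegral]
    convert (h2.sub (h1.const_mul (2 * c))).add_const (c ^ 2) using 2
    ring

/-- The values of the Laplace transform at `1` and `2` are the first two moments of `exp (-X)`. -/
theorem tendsto_diracProba_of_tendsto_laplace [l.IsCountablyGenerated]
    {σ : ι → ProbabilityMeasure ℝ≥0} {c : ℝ≥0}
    (h : ∀ s : ℝ, 0 < s → Tendsto (fun i => ∫ x, Real.exp (-(s * x)) ∂(σ i : Measure ℝ≥0)) l
      (𝓝 (Real.exp (-(s * c))))) :
    Tendsto σ l (𝓝 (diracProba c)) := by
  let expNeg (x : ℝ≥0) : ℝ := Real.exp (-x)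
  let negLog (z : ℝ) : ℝ≥0 := Real.toNNReal (-Real.log z)
  have hexp : Measurable expNeg := by fun_prop
  have hlog : Measurable negLog := by fun_prop
  have hmoment (s : ℕ) i : ∫ z, z ^ s ∂((σ i).map hexp.aemeasurable : Measure ℝ) =
      ∫ x, Real.exp (-(s * x)) ∂(σ i : Measure ℝ≥0) := by
    rw [ProbabilityMeasure.toMeasure_map, integral_map hexp.aemeasurable (by fun_prop)]
    simp only [expNeg, ← Real.exp_nat_mul, mul_neg]
  have hdirac : Tendsto (fun i => (σ i).map hexp.aemeasurable) l (𝓝 (diracProba (expNeg c))) := by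
    refine tendsto_diracProba_of_tendsto_moments (fun i => ?_) ?_ ?_
    · refine (memLp_map_measure_iff (by fun_prop) hexp.aemeasurable).mpr
        (MemLp.of_bound hexp.aestronglyMeasurable 1 (ae_of_all _ fun x => ?_))
      simp [expNeg]
    · have hmean := hmoment 1
      simp only [pow_one, Nat.cast_one] at hmean
      simpa only [hmean, expNeg, one_mul] using h 1 one_pos
    · have hsq : expNeg c ^ 2 = Real.exp (-(2 * c)) := by
        rw [← Real.exp_nat_mul, Nat.cast_two, mul_neg]
      simpa only [hmoment 2, hsq, Nat.cast_two] using h 2 two_pos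
  have hcont : ContinuousAt negLog (expNeg c) :=
    continuous_real_toNNReal.continuousAt.comp
      (Real.continuousAt_log (Real.exp_ne_zero _)).neg
  have hinv : negLog ∘ expNeg = id := funext fun x => by simp [negLog, expNeg]
  have hmap i : ((σ i).map hexp.aemeasurable).map hlog.aemeasurable = σ i := by
    apply ProbabilityMeasure.toMeasure_injective
    simp only [ProbabilityMeasure.toMeasure_map]
    rw [Measure.map_map hlog hexp, hinv, Measure.map_id]
  simpa only [hmap, ← Function.comp_apply (f := negLog), hinv, id] using
    tendsto_map_diracProba hdirac (fun _ => hlog) (hcont.tendsto.comp tendsto_snd)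

theorem continuous_mulConv {M : Type*} [Monoid M] [MeasurableSpace M] [TopologicalSpace M]
    [SecondCountableTopology M] [TopologicalSpace.PseudoMetrizableSpace M] [BorelSpace M]
    [ContinuousMul M] :
    Continuous fun μ : ProbabilityMeasure M × ProbabilityMeasure M => mulConv μ.1 μ.2 :=
  (ProbabilityMeasure.continuous_map continuous_mul).comp ProbabilityMeasure.continuous_prod

theorem mulConv_diracProba_one {M : Type*} [Monoid M] [MeasurableSpace M] [MeasurableMul₂ M]
    (μ : ProbabilityMeasure M) : mulConv μ (diracProba 1) = μ :=
  Subtype.ext (Measure.mconv_dirac_one _)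

theorem tendsto_powLaw_of_tendsto_diracProba_one [l.IsCountablyGenerated] {n : ℕ}
    {σ : ι → ProbabilityMeasure ℝ≥0} (hσ : Tendsto σ l (𝓝 (diracProba 1))) {γ : ι → Fin n → ℝ}
    {γ₀ : Fin n → ℝ} (hγ : Tendsto γ l (𝓝 γ₀)) :
    Tendsto (fun i => powLaw (σ i) (γ i)) l (𝓝 (diracProba 1)) := by
  refine tendsto_map_diracProba hσ (fun i => measurable_rpow_pi (γ i))
    (tendsto_pi_nhds.mpr fun k => ?_)
  have hk : Tendsto (fun i => γ i k) l (𝓝 (γ₀ k)) := tendsto_pi_nhds.mp hγ k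
  simpa [Function.uncurry_def] using
    (tendsto_snd (f := l) (g := 𝓝 (1 : ℝ≥0))).nnrpow (hk.comp tendsto_fst) (Or.inl one_ne_zero)

theorem tendsto_powLaw_of_tendsto_zero [l.IsCountablyGenerated] {n : ℕ}
    {σ : ProbabilityMeasure ℝ≥0} (hσ : (σ : Measure ℝ≥0) {0} = 0) {γ : ι → Fin n → ℝ}
    (hγ : Tendsto γ l (𝓝 0)) :
    Tendsto (fun i => powLaw σ (γ i)) l (𝓝 (diracProba 1)) := by
  have hae : ∀ᵐ x ∂(σ : Measure ℝ≥0), Tendsto (fun i k => x ^ γ i k) l (𝓝 (1 : Fin n → ℝ≥0)) := by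
    filter_upwards [compl_mem_ae_iff.mpr hσ] with x hx
    refine tendsto_pi_nhds.mpr fun k => ?_
    have hk : Tendsto (fun i => γ i k) l (𝓝 0) := tendsto_pi_nhds.mp hγ k
    simpa using (tendsto_const_nhds (x := x)).nnrpow hk (Or.inl hx)
  have hdistr := (tendstoInDistribution_of_ae_tendsto
    (fun i => (measurable_rpow_pi (γ i)).aemeasurable) aemeasurable_const hae).tendsto
  simp only [Measure.map_const, measure_univ, one_smul] at hdistr
  exact hdistr

theorem dense_setOf_ae_mem_finset {E : Type*} [EMetricSpace E]
    [SecondCountableTopology E] [MeasurableSpace E] [BorelSpace E] {D : Set E} (hD : Dense D) :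
    Dense {μ : ProbabilityMeasure E |
      ∃ s : Finset E, ↑s ⊆ D ∧ ∀ᵐ y ∂(μ : Measure E), y ∈ s} := by
  intro μ
  obtain ⟨x⟩ := μ.nonempty
  obtain ⟨y, hy⟩ := hD.nonempty_iff.mpr ⟨x⟩
  let F := SimpleFunc.approxOn id measurable_id D y hy
  refine mem_closure_of_tendsto (f := fun j => μ.map (F j).measurable.aemeasurable)
    (b := atTop) ?_ (Eventually.of_forall fun j => ⟨(F j).range, ?_, ?_⟩)
  · have h := (tendstoInDistribution_of_ae_tendsto (μ' := (μ : Measure E)) (Z := id)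
      (fun j => (F j).measurable.aemeasurable) aemeasurable_id (ae_of_all _ fun x =>
      SimpleFunc.tendsto_approxOn measurable_id hy (hD x))).tendsto
    simp only [Measure.map_id] at h
    exact h
  · rw [SimpleFunc.coe_range]
    exact Set.range_subset_iff.mpr (SimpleFunc.approxOn_mem measurable_id hy j)
  · exact (ae_map_iff (F j).measurable.aemeasurable (F j).range.measurableSet).mpr
      (ae_of_all _ (F j).mem_range_self)

theorem dense_of_mulConv_mem {n : ℕ} [l.NeBot] {τ : ι → ProbabilityMeasure (Fin n → ℝ≥0)}
    (hτ : Tendsto τ l (𝓝 (diracProba 1))) {S : Set (ProbabilityMeasure (Fin n → ℝ≥0))}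
    (hS : ∀ (ρ : ProbabilityMeasure (Fin n → ℝ≥0)) (s : Finset (Fin n → ℝ≥0)),
      (∀ y ∈ s, ∀ k, y k ≠ 0) → (∀ᵐ y ∂(ρ : Measure (Fin n → ℝ≥0)), y ∈ s) →
        ∀ i, mulConv ρ (τ i) ∈ S) :
    Dense S := by
  have horthant : Dense {y : Fin n → ℝ≥0 | ∀ k, y k ≠ 0} := by
    simpa [Set.pi] using dense_pi Set.univ fun _ _ => dense_compl_singleton (0 : ℝ≥0)
  refine dense_closure.mp ((dense_setOf_ae_mem_finset horthant).mono ?_)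
  rintro ρ ⟨s, hs, hρ⟩
  have hlim : Tendsto (fun i => mulConv ρ (τ i)) l (𝓝 ρ) := by
    simpa only [mulConv_diracProba_one, Function.comp_def] using
      (continuous_mulConv.tendsto (ρ, diracProba 1)).comp (tendsto_const_nhds.prodMk_nhds hτ)
  exact mem_closure_of_tendsto hlim (Eventually.of_forall (hS ρ s hs hρ))

end WeakConvergence

section Marginals

theorem measure_singleton_zero_of_tendsto_laplace {σ : ProbabilityMeasure ℝ≥0}
    (h : Tendsto (fun s : ℝ => ∫ x, Real.exp (-(s * x)) ∂(σ : Measure ℝ≥0)) atTop (𝓝 0)) :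
    (σ : Measure ℝ≥0) {0} = 0 := by
  have hle : ∀ s : ℝ, 0 ≤ s →
      (σ : Measure ℝ≥0).real {0} ≤ ∫ x, Real.exp (-(s * x)) ∂(σ : Measure ℝ≥0) := by
    intro s hs
    rw [← integral_indicator_one (measurableSet_singleton _)]
    refine integral_mono ((integrable_const (1 : ℝ)).indicator (measurableSet_singleton _))
      (.of_bound (by fun_prop) 1 (ae_of_all _ fun x => ?_)) fun x => ?_
    · rw [Real.norm_of_nonneg (Real.exp_pos _).le, Real.exp_le_one_iff, neg_nonpos]
      positivity
    · by_cases hx : x = 0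
      · simp [hx]
      · simpa [hx] using (Real.exp_pos _).le
  have hzero : (σ : Measure ℝ≥0).real {0} ≤ 0 :=
    ge_of_tendsto h ((eventually_ge_atTop 0).mono hle)
  exact (measureReal_eq_zero_iff (by finiteness)).mp (le_antisymm hzero measureReal_nonneg)

theorem ae_mulConv_powLaw_ne_zero {n : ℕ} {k : Fin n} {ρ : ProbabilityMeasure (Fin n → ℝ≥0)}
    (hρ : ∀ᵐ y ∂(ρ : Measure (Fin n → ℝ≥0)), y k ≠ 0) {σ : ProbabilityMeasure ℝ≥0}
    (hσ : (σ : Measure ℝ≥0) {0} = 0) (γ : Fin n → ℝ) :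
    ∀ᵐ y ∂(mulConv ρ (powLaw σ γ) : Measure (Fin n → ℝ≥0)), y k ≠ 0 := by
  have hset : MeasurableSet {y : Fin n → ℝ≥0 | y k ≠ 0} :=
    (measurable_pi_apply k) (measurableSet_singleton 0).compl
  have hpow : ∀ᵐ y ∂(powLaw σ γ : Measure (Fin n → ℝ≥0)), y k ≠ 0 := by
    refine (ae_map_iff (measurable_rpow_pi γ).aemeasurable hset).mpr ?_
    filter_upwards [compl_mem_ae_iff.mpr hσ] with x hx
    exact (NNReal.rpow_pos (pos_iff_ne_zero.mpr hx)).ne'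
  refine (ae_map_iff measurable_mul.aemeasurable hset).mpr ?_
  filter_upwards [Measure.quasiMeasurePreserving_fst.ae hρ,
    Measure.quasiMeasurePreserving_snd.ae hpow] with z hfst hsnd
  exact mul_ne_zero hfst hsnd

end Marginals

section ErlangLimits

theorem IsErlangMittagLeffler.measure_singleton_zero {α : ℝ} {m : ℕ} {σ : ProbabilityMeasure ℝ≥0}
    (hσ : IsErlangMittagLeffler α m σ) (hα : 0 < α) (hm : m ≠ 0) : (σ : Measure ℝ≥0) {0} = 0 := by
  have hlim : Tendsto (fun s : ℝ => ((1 + s ^ α / m) ^ m)⁻¹) atTop (𝓝 0) :=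
    tendsto_inv_atTop_zero.comp ((tendsto_pow_atTop hm).comp
      (tendsto_atTop_add_const_left _ _
        ((tendsto_rpow_atTop hα).atTop_div_const (by positivity))))
  exact measure_singleton_zero_of_tendsto_laplace
    (hlim.congr' ((eventually_ge_atTop 0).mono fun s hs => (hσ s hs).symm))

theorem tendsto_diracProba_one_of_isErlangMittagLeffler {α : ℕ → ℝ}
    (hα : Tendsto α atTop (𝓝 1)) {σ : ℕ → ProbabilityMeasure ℝ≥0}
    (hσ : ∀ j, IsErlangMittagLeffler (α j) j (σ j)) :
    Tendsto σ atTop (𝓝 (diracProba 1)) := by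
  refine tendsto_diracProba_of_tendsto_laplace fun s hs => ?_
  have hpow : Tendsto (fun j => s ^ α j) atTop (𝓝 s) := by
    simpa using tendsto_const_nhds.rpow hα (Or.inl hs.ne')
  have hexp : Tendsto (fun j : ℕ => (1 + s ^ α j / (j : ℝ)) ^ j) atTop (𝓝 (Real.exp s)) := by
    refine Real.tendsto_one_add_pow_exp_of_tendsto
      (hpow.congr' ((eventually_ne_atTop 0).mono fun j hj => ?_))
    exact (mul_div_cancel₀ _ (Nat.cast_ne_zero.mpr hj)).symm
  simp only [hσ _ s hs.le, NNReal.coe_one, mul_one, Real.exp_neg s]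
  exact hexp.inv₀ (Real.exp_ne_zero s)

theorem exists_tendsto_isErlangMittagLeffler :
    ∃ (α : ℕ → ℝ) (σ : ℕ → ProbabilityMeasure ℝ≥0),
      (∀ j, 0 < α j ∧ α j < 1 ∧ IsErlangMittagLeffler (α j) (j + 1) (σ j)) ∧
        Tendsto α atTop (𝓝 1) ∧ Tendsto σ atTop (𝓝 (diracProba 1)) := by
  let α (j : ℕ) : ℝ := (j + 1 : ℕ) / ((j + 1 : ℕ) + 1)
  have hpos j : 0 < α j := by positivity
  have hlt j : α j < 1 := (div_lt_one (by positivity)).mpr (lt_add_one _)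
  have hα : Tendsto α atTop (𝓝 1) :=
    (tendsto_natCast_div_add_atTop (1 : ℝ)).comp (tendsto_add_atTop_nat 1)
  choose σ hσ using fun j => exists_isErlangMittagLeffler (hpos (j - 1)) (hlt (j - 1)).le j
  refine ⟨α, fun j => σ (j + 1), fun j => ⟨hpos j, hlt j, hσ (j + 1)⟩, hα, ?_⟩
  have hshift : Tendsto (fun j => α (j - 1)) atTop (𝓝 1) :=
    hα.comp (tendsto_sub_atTop_nat 1)
  exact (tendsto_diracProba_one_of_isErlangMittagLeffler hshift hσ).comp
    (tendsto_add_atTop_nat 1)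

variable {n m : ℕ} {α : ℝ} {σ : ProbabilityMeasure ℝ≥0} {ρ : ProbabilityMeasure (Fin n → ℝ≥0)}
  {s : Finset (Fin n → ℝ≥0)}

theorem IsErlangMittagLeffler.mulConv_mem_MPHStar (hσ : IsErlangMittagLeffler α (m + 1) σ)
    (hs : ∀ᵐ y ∂(ρ : Measure (Fin n → ℝ≥0)), y ∈ s) :
    mulConv ρ (powLaw σ 1) ∈ MPHStar n α :=
  mulConv_powLaw_one_mem_MPHStar (single_mem_stdSimplex ℝ _)
    (isTransientGenerator_erlangChain m (by positivity)) hσ.hasPhaseTypeLaw hs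

theorem IsErlangMittagLeffler.mulConv_mem_MPHStarPow (hσ : IsErlangMittagLeffler α (m + 1) σ)
    {ν : Fin n → ℝ} (hν : ∀ k, ν k ≠ 0) (hs : ∀ᵐ y ∂(ρ : Measure (Fin n → ℝ≥0)), y ∈ s) :
    mulConv ρ (powLaw σ (1 / ν)) ∈ MPHStarPow n α ν :=
  mulConv_powLaw_mem_MPHStarPow (single_mem_stdSimplex ℝ _)
    (isTransientGenerator_erlangChain m (by positivity)) hσ.hasPhaseTypeLaw hν hs

end ErlangLimits

end FractionalPhaseType

open Filter Topology FractionalPhaseType in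
theorem mainTheorem3 (n : ℕ) :
    Dense {μ : ProbabilityMeasure (Fin n → ℝ≥0) |
      ∃ α : ℝ, 0 < α ∧ α < 1 ∧ μ ∈ FractionalPhaseType.MPHStar n α} ∧
    (∀ α : ℝ, 0 < α → α ≤ 1 →
      Dense {μ : ProbabilityMeasure (Fin n → ℝ≥0) |
        ∃ ν : Fin n → ℝ, (∀ k, 0 < ν k) ∧ μ ∈ FractionalPhaseType.MPHStarPow n α ν}) ∧
    (∀ β : Fin n → ℝ, (∀ k, 0 < β k) →
      Dense {μ : ProbabilityMeasure (Fin n → ℝ≥0) |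
        (∃ (α : ℝ) (ν : Fin n → ℝ), 0 < α ∧ α < 1 ∧ (∀ k, 0 < ν k ∧ α / ν k = β k) ∧
          μ ∈ FractionalPhaseType.MPHStarPow n α ν) ∧
        ∀ k, (μ : Measure (Fin n → ℝ≥0)) {y | y k ≠ 0} ≠ 0}) := by
  refine ⟨?_, fun α h0 h1 => ?_, fun β hβ => ?_⟩
  · obtain ⟨α, σ, hσ, -, hlim⟩ := exists_tendsto_isErlangMittagLeffler
    exact dense_of_mulConv_mem (tendsto_powLaw_of_tendsto_diracProba_one hlim tendsto_const_nhds)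
      fun ρ s _ hs j => ⟨α j, (hσ j).1, (hσ j).2.1, (hσ j).2.2.mulConv_mem_MPHStar hs⟩
  · obtain ⟨σ, hσ⟩ := exists_isErlangMittagLeffler h0 h1 1
    have hγ : Tendsto (fun j : ℕ => 1 / fun _ : Fin n => (j : ℝ) + 1) atTop (𝓝 0) :=
      tendsto_pi_nhds.mpr fun _ => tendsto_one_div_add_atTop_nhds_zero_nat
    refine dense_of_mulConv_mem
      (tendsto_powLaw_of_tendsto_zero (hσ.measure_singleton_zero h0 one_ne_zero) hγ)
      fun ρ s _ hs j => ⟨fun _ => j + 1, fun _ => by positivity, ?_⟩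
    exact hσ.mulConv_mem_MPHStarPow (fun _ => by positivity) hs
  · obtain ⟨α, σ, hσ, hα, hlim⟩ := exists_tendsto_isErlangMittagLeffler
    have hν j k : 0 < α j / β k := div_pos (hσ j).1 (hβ k)
    have hγ : Tendsto (fun j => 1 / fun k => α j / β k) atTop (𝓝 (1 / fun k => 1 / β k)) :=
      tendsto_pi_nhds.mpr fun k => tendsto_const_nhds.div (hα.div_const _)
        (one_div_pos.mpr (hβ k)).ne'
    refine dense_of_mulConv_mem (tendsto_powLaw_of_tendsto_diracProba_one hlim hγ)
      fun ρ s hpos hs j => ⟨⟨α j, fun k => α j / β k, (hσ j).1, (hσ j).2.1,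
        fun k => ⟨hν j k, div_div_cancel₀ (hσ j).1.ne'⟩,
        (hσ j).2.2.mulConv_mem_MPHStarPow (fun k => (hν j k).ne') hs⟩, fun k => ?_⟩
    exact frequently_ae_iff.mp (ae_mulConv_powLaw_ne_zero (hs.mono fun y hy => hpos y hy k)
      ((hσ j).2.2.measure_singleton_zero (hσ j).1 (Nat.succ_ne_zero j)) _).frequently
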